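/- Call an uncountable cardinal $\kappa$ real-valued measurable if there is a $\kappa$-additive probability measure defined on all subsets of $\kappa$ and vanishing on singletons. Call $g:\mathbf R\to\mathbf R$ approximately continuous if for every open $U\subseteq\mathbf R$ the set $g^{-1}(U)$ is Lebesgue measurable and has Lebesgue density one at each of its points. A real-valued function on a topological space is Baire $0$ if it is continuous, and, for an ordinal $\alpha>0$, Baire $\alpha$ if it is the pointwise limit of a sequence of functions each of which is Baire $\beta$ for some $\beta<\alpha$. Theorem. Suppose there exists a real-valued measurable cardinal $\kappa\le 2^{\aleph_0}$ (that is, one carrying a witnessing measure without atoms). Then for every function $f:\mathbf R^2\to\mathbf R$ and every ordinal $\alpha<\omega_1$: if for every $x\in\mathbf R$ the section $f_x(y)=f(x,y)$ is approximately continuous in $y$, and for every $y\in\mathbf R$ the section $f^y(x)=f(x,y)$ is Baire $\alpha$ in $x$, then $f$ is Baire $\alpha+1$ as a function of two variables. -/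

import Mathlib

open MeasureTheory Filter Topology
open scoped Cardinal Ordinal

/-- An uncountable cardinal `κ` is real-valued measurable if there is a probability measure defined
on all subsets of `κ` that vanishes on singletons and is `κ`-additive, that is, additive over
families of fewer than `κ` pairwise disjoint sets. (A two-valued measure is allowed.) -/
def IsRealValuedMeasurable.{u} (κ : Cardinal.{u}) : Prop :=
  ℵ₀ < κ ∧
    ∃ μ : @Measure κ.out ⊤,
      IsProbabilityMeasure μ ∧
      (∀ a : κ.out, μ {a} = 0) ∧
      ∀ (ι : Type u) (A : ι → Set κ.out), #ι < κ → Pairwise (fun i j => Disjoint (A i) (A j)) →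
        μ (⋃ i, A i) = ∑' i, μ (A i)

/-- The set `E ⊆ ℝ` has Lebesgue density one at the point `t`. -/
def HasDensityOneAt (E : Set ℝ) (t : ℝ) : Prop :=
  Tendsto (fun r : ℝ => volume (E ∩ Set.Icc (t - r) (t + r)) / volume (Set.Icc (t - r) (t + r)))
    (𝓝[>] 0) (𝓝 1)

/-- `g : ℝ → ℝ` is approximately continuous: the preimage of every open set is Lebesgue measurable
and has Lebesgue density one at each of its points. -/
def IsApproxContinuous (g : ℝ → ℝ) : Prop :=
  ∀ U : Set ℝ, IsOpen U →
    NullMeasurableSet (g ⁻¹' U) volume ∧ ∀ t ∈ g ⁻¹' U, HasDensityOneAt (g ⁻¹' U) t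

/-- The Baire classes of real-valued functions: the functions of class `0` are the continuous ones,
and for `0 < α` those of class `α` are the pointwise limits of sequences of functions each of which
is of some class less than `α`. -/
inductive IsBaire {X : Type*} [TopologicalSpace X] : Ordinal.{0} → (X → ℝ) → Prop
  | zero {g : X → ℝ} (hg : Continuous g) : IsBaire 0 g
  | lim {α : Ordinal.{0}} {g : X → ℝ} (β : ℕ → Ordinal.{0}) (u : ℕ → X → ℝ)
      (hβ : ∀ n, β n < α) (hu : ∀ n, IsBaire (β n) (u n))
      (h : ∀ x, Tendsto (fun n => u n x) atTop (𝓝 (g x))) : IsBaire α g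

/-!
The hypothesis is used only through a probability measure `μ` on all subsets of a set `Ω` of size at
most `𝔠`, vanishing on points. Embed `Ω` in `ℝ` and compose with the cumulative distribution
function of the image measure, which is continuous: the result is a function `T : Ω → [0, 1]` whose
law is Lebesgue measure (`exists_uniform_variable`). Every function on `Ω` is measurable, so
`∫ f (x, a + T / N) ∂μ` is an average of `f (x, ·)` over `[a, a + 1 / N]` that behaves well
*as a function of `x`*, although nothing is known about the joint measurability of `f`.

Indeed, integrating a uniformly bounded family of functions of class `α < ω₁` over `μ` gives a
function of class `α` (`IsBaire.integral`): choose approximating sequences for the members of the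
family independently, along one common sequence of lower classes (`IsBaire.exists_uniform_seq`), and
apply dominated convergence and induction. The choice cannot spoil measurability.

For bounded `f`, interpolate these averages in the variable `y` with hat functions on a mesh of width
`1 / N`. The interpolants are of class `α` on the plane, and they converge to `f` as `N → ∞` because
`f (x, ·)` is approximately continuous (`abs_integral_sub_le`, `exists_seq_of_bounded`). So `f` is of
class `α + 1`. The general case follows by passing to `arctan ∘ f` and back (`IsBaire.of_arctan`).
-/

/-! ### Closure properties of the Baire classes -/

namespace IsBaire

variable {X Y : Type*} [TopologicalSpace X] [TopologicalSpace Y]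

theorem continuous_of_zero {g : X → ℝ} (hg : IsBaire 0 g) : Continuous g := by
  cases hg with
  | zero hg => exact hg
  | lim β u hβ _ _ => exact absurd (hβ 0) not_lt_zero

theorem exists_seq {α : Ordinal.{0}} (hα : 0 < α) {g : X → ℝ} (hg : IsBaire α g) :
    ∃ (β : ℕ → Ordinal.{0}) (u : ℕ → X → ℝ), (∀ n, β n < α) ∧ (∀ n, IsBaire (β n) (u n)) ∧
      ∀ x, Tendsto (fun n => u n x) atTop (𝓝 (g x)) := by
  cases hg with
  | zero hg => exact absurd hα (lt_irrefl _)
  | lim β u hβ hu h => exact ⟨β, u, hβ, hu, h⟩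

theorem mono {α β : Ordinal.{0}} {g : X → ℝ} (hg : IsBaire α g) (h : α ≤ β) : IsBaire β g := by
  rcases h.eq_or_lt with rfl | hlt
  · exact hg
  · exact lim (fun _ => α) (fun _ => g) (fun _ => hlt) (fun _ => hg) fun _ => tendsto_const_nhds

theorem of_continuous {g : X → ℝ} (hg : Continuous g) (α : Ordinal.{0}) : IsBaire α g :=
  (zero hg).mono (zero_le (a := α))

theorem comp_continuous {α : Ordinal.{0}} {g : X → ℝ} (hg : IsBaire α g) {k : Y → X}
    (hk : Continuous k) : IsBaire α (fun y => g (k y)) := by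
  induction hg with
  | zero hg => exact zero (hg.comp hk)
  | lim β u hβ _ h ih => exact lim β (fun n y => u n (k y)) hβ ih fun y => h (k y)

theorem continuous_comp {α : Ordinal.{0}} {g : X → ℝ} (hg : IsBaire α g) {φ : ℝ → ℝ}
    (hφ : Continuous φ) : IsBaire α (fun x => φ (g x)) := by
  induction hg with
  | zero hg => exact zero (hφ.comp hg)
  | lim β u hβ _ h ih =>
    exact lim β (fun n x => φ (u n x)) hβ ih fun x => (hφ.tendsto _).comp (h x)

theorem continuous_comp₂ {φ : ℝ × ℝ → ℝ} (hφ : Continuous φ) {α : Ordinal.{0}} {g h : X → ℝ}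
    (hg : IsBaire α g) (hh : IsBaire α h) : IsBaire α (fun x => φ (g x, h x)) := by
  induction α using WellFoundedLT.induction generalizing g h with
  | ind α ih =>
    rcases eq_zero_or_pos α with rfl | hα
    · exact zero (hφ.comp (hg.continuous_of_zero.prodMk hh.continuous_of_zero))
    · obtain ⟨β, u, hβ, hu, hug⟩ := hg.exists_seq hα
      obtain ⟨γ, v, hγ, hv, hvh⟩ := hh.exists_seq hα
      refine lim (fun n => max (β n) (γ n)) (fun n x => φ (u n x, v n x))
        (fun n => max_lt (hβ n) (hγ n)) (fun n => ih _ (max_lt (hβ n) (hγ n))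
          ((hu n).mono (le_max_left _ _)) ((hv n).mono (le_max_right _ _))) fun x => ?_
      exact (hφ.tendsto (g x, h x)).comp ((hug x).prodMk_nhds (hvh x))

theorem mul {α : Ordinal.{0}} {g h : X → ℝ} (hg : IsBaire α g) (hh : IsBaire α h) :
    IsBaire α (fun x => g x * h x) :=
  continuous_comp₂ continuous_mul hg hh

theorem sum {ι : Type*} {α : Ordinal.{0}} (s : Finset ι) {g : ι → X → ℝ}
    (hg : ∀ i, IsBaire α (g i)) : IsBaire α (fun x => ∑ i ∈ s, g i x) := by
  classical
  induction s using Finset.induction_on with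
  | empty => simpa using of_continuous (X := X) continuous_const α
  | insert i s hi ih =>
    simp only [Finset.sum_insert hi]
    exact continuous_comp₂ continuous_add (hg i) ih

/-- A countable class `α > 0` has a single sequence of lower classes along which every function of
class `α` can be approximated. This is what allows functions to be approximated simultaneously. -/
theorem exists_uniform_seq {α : Ordinal.{0}} (hα : 0 < α) (hα₁ : α < ω_ 1) :
    ∃ γ : ℕ → Ordinal.{0}, (∀ k, γ k < α) ∧ ∀ g : X → ℝ, IsBaire α g →
      ∃ u : ℕ → X → ℝ, (∀ k, IsBaire (γ k) (u k)) ∧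
        ∀ x, Tendsto (fun k => u k x) atTop (𝓝 (g x)) := by
  have hcount : (Set.Iio α).Countable := by
    rw [← Cardinal.le_aleph0_iff_set_countable, Cardinal.mk_Iio_ordinal, Cardinal.lift_le_aleph0,
      ← Order.lt_succ_iff, Cardinal.succ_aleph0]
    rwa [← Cardinal.ord_aleph, Cardinal.lt_ord] at hα₁
  obtain ⟨s, hs⟩ := hcount.exists_eq_range ⟨0, hα⟩
  have hsα : ∀ i, s i < α := fun i => by
    have : s i ∈ Set.Iio α := hs ▸ Set.mem_range_self i
    exact this
  refine ⟨fun k => partialSups s k, fun k => ?_, fun g hg => ?_⟩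
  · obtain ⟨i, -, hi⟩ := exists_partialSups_eq s k
    exact hi.trans_lt (hsα i)
  · obtain ⟨β, u, hβ, hu, hug⟩ := hg.exists_seq hα
    classical
    -- `m k` is the last index up to `k` of a term whose class is already covered at stage `k`
    let m : ℕ → ℕ := fun k => Nat.findGreatest (fun n => β n ≤ partialSups s k) k
    have hm : ∀ n, ∀ᶠ k in atTop, n ≤ m k ∧ β (m k) ≤ partialSups s k := fun n => by
      have : β n ∈ Set.range s := hs ▸ hβ n
      obtain ⟨i, hi⟩ := this
      filter_upwards [eventually_ge_atTop n, eventually_ge_atTop i] with k hkn hki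
      have h : β n ≤ partialSups s k := hi ▸ le_partialSups_of_le s hki
      exact ⟨Nat.le_findGreatest hkn h,
        Nat.findGreatest_spec (P := fun n => β n ≤ partialSups s k) hkn h⟩
    refine ⟨fun k => if β (m k) ≤ partialSups s k then u (m k) else 0, fun k => ?_, fun x => ?_⟩
    · dsimp only
      split_ifs with h
      · exact (hu _).mono h
      · exact of_continuous continuous_const _
    · have hlim : Tendsto m atTop atTop := tendsto_atTop.2 fun n => (hm n).mono fun _ h => h.1
      refine ((hug x).comp hlim).congr' ?_
      filter_upwards [hm 0] with k hk
      simp [hk.2]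

/-- Integration preserves the class. Approximating sequences are truncated, and chosen independently for each `a`:
every function on `Ω` is measurable, so this choice does not affect measurability. -/
theorem integral [FirstCountableTopology X] {Ω : Type*} [MeasurableSpace Ω]
    [DiscreteMeasurableSpace Ω] (μ : Measure Ω) [IsFiniteMeasure μ] {α : Ordinal.{0}}
    (hα : α < ω_ 1) {M : ℝ} {h : X → Ω → ℝ} (hM : ∀ x a, |h x a| ≤ M)
    (hh : ∀ a, IsBaire α (fun x => h x a)) : IsBaire α (fun x => ∫ a, h x a ∂μ) := by
  induction α using WellFoundedLT.induction generalizing h with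
  | ind α ih =>
    rcases eq_zero_or_pos α with rfl | hpos
    · refine zero (continuous_of_dominated (bound := fun _ => M)
        (fun x => Measurable.of_discrete.aestronglyMeasurable)
        (fun x => ae_of_all _ fun a => hM x a) (integrable_const M)
        (ae_of_all _ fun a => (hh a).continuous_of_zero))
    · obtain ⟨γ, hγ, H⟩ := exists_uniform_seq (X := X) hpos hα
      choose u hu hlim using fun a => H _ (hh a)
      let c : ℝ → ℝ := fun t => max (-M) (min M t)
      have hc : Continuous c := by fun_prop
      refine lim γ (fun k x => ∫ a, c (u a k x) ∂μ) hγ (fun k => ?_) fun x => ?_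
      · refine ih _ (hγ k) ((hγ k).trans hα) (h := fun x a => c (u a k x)) (fun x a => ?_)
          fun a => (hu a k).continuous_comp hc
        have : 0 ≤ M := (abs_nonneg _).trans (hM x a)
        exact abs_le.2 ⟨le_max_left _ _, max_le (by linarith) (min_le_left _ _)⟩
      · refine tendsto_integral_of_dominated_convergence (fun _ => M)
          (fun k => Measurable.of_discrete.aestronglyMeasurable) (integrable_const M)
          (fun k => ae_of_all _ fun a => ?_) (ae_of_all _ fun a => ?_)
        · have : 0 ≤ M := (abs_nonneg _).trans (hM x a)
          exact abs_le.2 ⟨le_max_left _ _, max_le (by linarith) (min_le_left _ _)⟩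
        · have hx := abs_le.1 (hM x a)
          have h0 : c (h x a) = h x a := by simp only [c, min_eq_right hx.2, max_eq_right hx.1]
          have := (hc.tendsto (h x a)).comp (hlim a x)
          rwa [h0] at this

end IsBaire

/-! ### A uniformly distributed variable on a universally measured space -/

/-- The probability integral transform. -/
theorem map_cdf_eq_volume_restrict (ν : Measure ℝ) [IsProbabilityMeasure ν] [NullSingletonClass ν] :
    ν.map (ProbabilityTheory.cdf ν) = volume.restrict (Set.Icc 0 1) := by
  set F := ProbabilityTheory.cdf ν with hF
  have hmono : Monotone F := ProbabilityTheory.monotone_cdf ν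
  have hcont : Continuous F := by
    refine continuous_iff_continuousAt.2 fun a => ?_
    have h1 : F.measure {a} = 0 := by
      rw [hF, ProbabilityTheory.measure_cdf]; exact measure_singleton a
    rw [StieltjesFunction.measure_singleton, ENNReal.ofReal_eq_zero] at h1
    refine hmono.continuousAt_iff_leftLim_eq_rightLim.2 ?_
    rw [F.rightLim_eq]
    exact le_antisymm (hmono.leftLim_le le_rfl) (by linarith)
  have hIic : ∀ x, ν (Set.Iic x) = ENNReal.ofReal (F x) := fun x =>
    (ProbabilityTheory.ofReal_cdf ν x).symm
  have hsurj : ∀ v, 0 < v → v < 1 → ∃ x, F x = v := fun v h0 h1 => by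
    obtain ⟨a, ha⟩ := ((ProbabilityTheory.tendsto_cdf_atBot ν).eventually (gt_mem_nhds h0)).exists
    obtain ⟨b, hb⟩ := ((ProbabilityTheory.tendsto_cdf_atTop ν).eventually (lt_mem_nhds h1)).exists
    exact mem_range_of_exists_le_of_exists_ge hcont ⟨a, ha.le⟩ ⟨b, hb.le⟩
  refine Measure.ext_of_Iic _ _ fun u => ?_
  rw [Measure.map_apply hmono.measurable measurableSet_Iic,
    Measure.restrict_apply measurableSet_Iic]
  have hset : Set.Iic u ∩ Set.Icc (0 : ℝ) 1 = Set.Icc 0 (min u 1) := by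
    ext t; simp only [Set.mem_inter_iff, Set.mem_Iic, Set.mem_Icc, le_min_iff]; tauto
  rw [hset, Real.volume_Icc, sub_zero]
  rcases le_or_gt 1 u with hu | hu
  · rw [min_eq_right hu, ENNReal.ofReal_one]
    have : F ⁻¹' Set.Iic u = Set.univ :=
      Set.eq_univ_of_forall fun x => (ProbabilityTheory.cdf_le_one ν x).trans hu
    rw [this, measure_univ]
  · rw [min_eq_left hu.le]
    refine le_antisymm ?_ ?_
    · have key : ∀ v ∈ Set.Ioo (max u 0) 1, ν (F ⁻¹' Set.Iic u) ≤ ENNReal.ofReal v := by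
        rintro v ⟨hv, hv1⟩
        obtain ⟨x, rfl⟩ := hsurj v ((le_max_right _ _).trans_lt hv) hv1
        rw [← hIic]
        refine measure_mono fun y hy => ?_
        by_contra! h
        have hy' : F y ≤ u := hy
        have := hmono (not_le.1 h).le
        linarith [le_max_left u 0]
      have hlt : max u 0 < 1 := max_lt hu one_pos
      have := ge_of_tendsto (b := ν (F ⁻¹' Set.Iic u))
        ((ENNReal.continuous_ofReal.tendsto (max u 0)).mono_left
          (nhdsWithin_le_nhds (s := Set.Ioi (max u 0))))
        (by filter_upwards [Ioo_mem_nhdsGT hlt] with v hv using key v hv)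
      rwa [ENNReal.ofReal_max, ENNReal.ofReal_zero, max_eq_left zero_le] at this
    · rcases le_or_gt u 0 with h0 | h0
      · simp [ENNReal.ofReal_of_nonpos h0]
      · obtain ⟨x, rfl⟩ := hsurj u h0 hu
        rw [← hIic]
        exact measure_mono fun y hy => hmono hy

/-- A measure on all subsets of `Ω` carries a variable `T` with the uniform law on `[0, 1]`: the
cumulative distribution function of an embedding in `ℝ`. The bound holds for all sets `D` of reals,
`volume D` being the outer measure if `D` is not measurable. In this way `D ↦ μ (T ⁻¹' D)` extends
Lebesgue measure on `[0, 1]` to all sets, without a second σ-algebra on `ℝ`. -/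
theorem exists_uniform_variable {Ω : Type} [MeasurableSpace Ω] [DiscreteMeasurableSpace Ω]
    (μ : Measure Ω) [IsProbabilityMeasure μ] (h0 : ∀ a, μ {a} = 0) (hΩ : #Ω ≤ 𝔠) :
    ∃ T : Ω → ℝ, (∀ a, T a ∈ Set.Icc (0 : ℝ) 1) ∧ ∀ D : Set ℝ, μ (T ⁻¹' D) ≤ volume D := by
  rw [← Cardinal.mk_real] at hΩ
  obtain ⟨e⟩ := hΩ
  have he : Measurable e := Measurable.of_discrete
  have := Measure.isProbabilityMeasure_map (μ := μ) he.aemeasurable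
  have : NullSingletonClass μ := ⟨h0⟩
  have : NullSingletonClass (μ.map e) := ⟨fun x => by
    rw [Measure.map_apply he (measurableSet_singleton x)]
    refine Set.Subsingleton.measure_zero (fun a ha b hb => e.injective ?_) _
    exact (show e a = x from ha).trans (show e b = x from hb).symm⟩
  let F := ProbabilityTheory.cdf (μ.map e)
  have hF : Measurable F := (ProbabilityTheory.monotone_cdf _).measurable
  refine ⟨fun a => F (e a), fun a => ⟨ProbabilityTheory.cdf_nonneg _ _,
    ProbabilityTheory.cdf_le_one _ _⟩, fun D => ?_⟩
  have h := Measure.le_map_apply (μ := μ) (f := fun a => F (e a))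
    Measurable.of_discrete.aemeasurable D
  refine h.trans ?_
  have h2 : μ.map (fun a => F (e a)) = (μ.map e).map F := (Measure.map_map hF he).symm
  rw [h2, map_cdf_eq_volume_restrict]
  exact Measure.restrict_apply_le _ _

/-! ### Averages of approximately continuous functions -/

theorem HasDensityOneAt.tendsto_compl {E : Set ℝ} {t : ℝ} (hE : NullMeasurableSet E volume)
    (h : HasDensityOneAt E t) :
    Tendsto (fun r : ℝ => volume.real (Set.Icc (t - r) (t + r) \ E) / r) (𝓝[>] 0) (𝓝 0) := by
  have h1 := (ENNReal.tendsto_toReal ENNReal.one_ne_top).comp h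
  have h2 : Tendsto (fun r : ℝ => 2 * (1 - (volume (E ∩ Set.Icc (t - r) (t + r)) /
      volume (Set.Icc (t - r) (t + r))).toReal)) (𝓝[>] 0) (𝓝 0) := by
    simpa using (h1.const_sub 1).const_mul 2
  refine h2.congr' ?_
  filter_upwards [self_mem_nhdsWithin] with r hr
  have hr : 0 < r := hr
  have hI : volume.real (Set.Icc (t - r) (t + r)) = 2 * r := by
    rw [Real.volume_real_Icc_of_le (by linarith)]; ring
  have hsplit : volume.real (Set.Icc (t - r) (t + r) ∩ E) +
      volume.real (Set.Icc (t - r) (t + r) \ E) = volume.real (Set.Icc (t - r) (t + r)) :=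
    measureReal_inter_add_sdiff₀ (s := Set.Icc (t - r) (t + r)) (t := E)
      (h := measure_Icc_lt_top.ne) (ht := hE)
  rw [ENNReal.toReal_div, ← measureReal_def, ← measureReal_def, Set.inter_comm, hI]
  rw [hI] at hsplit
  have : volume.real (Set.Icc (t - r) (t + r) \ E) =
      2 * r - volume.real (Set.Icc (t - r) (t + r) ∩ E) := by linarith
  rw [this]
  field_simp

theorem IsApproxContinuous.continuous_comp {g φ : ℝ → ℝ} (hg : IsApproxContinuous g)
    (hφ : Continuous φ) : IsApproxContinuous (fun t => φ (g t)) :=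
  fun U hU => hg (φ ⁻¹' U) (hU.preimage hφ)

/-- Averages over intervals of length `1 / N` near `y` are compared with `g y`: the points where
`g` is not close to `g y` have small measure in the interval of radius `2 / N` around `y`. -/
theorem abs_integral_sub_le {Ω : Type} [MeasurableSpace Ω] [DiscreteMeasurableSpace Ω]
    {μ : Measure Ω} [IsProbabilityMeasure μ] {T : Ω → ℝ} (hT : ∀ w, T w ∈ Set.Icc (0 : ℝ) 1)
    (hTμ : ∀ D : Set ℝ, μ (T ⁻¹' D) ≤ volume D) {g : ℝ → ℝ} {M : ℝ} (hM : ∀ t, |g t| ≤ M)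
    {ε : ℝ} (hε : 0 ≤ ε) {N a y : ℝ} (hN : 0 < N) (ha : |y - a| ≤ 2 / N) (hay : a ≤ y) :
    |∫ w, g (a + T w / N) ∂μ - g y| ≤
      ε + 4 * M * (volume.real (Set.Icc (y - 2 / N) (y + 2 / N) \ g ⁻¹' Metric.ball (g y) ε) /
        (2 / N)) := by
  have hM0 : 0 ≤ M := (abs_nonneg _).trans (hM 0)
  set B := Set.Icc (y - 2 / N) (y + 2 / N) \ g ⁻¹' Metric.ball (g y) ε with hB
  have hBfin : volume B ≠ ⊤ :=
    measure_ne_top_of_subset Set.sdiff_subset (by simp)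
  have hint : ∀ φ : Ω → ℝ, ∀ C : ℝ, (∀ w, |φ w| ≤ C) → Integrable φ μ := fun φ C h =>
    Integrable.of_bound Measurable.of_discrete.aestronglyMeasurable C (ae_of_all _ h)
  set S : Set Ω := {w | a + T w / N ∈ B} with hS
  have hμS : μ.real S ≤ N * volume.real B := by
    have h1 : μ S ≤ volume ((fun s => N⁻¹ * s) ⁻¹' ((fun s => a + s) ⁻¹' B)) := by
      refine le_trans (measure_mono fun w hw => ?_) (hTμ _)
      have hw : a + T w / N ∈ B := hw
      simpa only [Set.mem_preimage, div_eq_inv_mul] using hw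
    rw [Real.volume_preimage_mul_left (inv_pos.2 hN).ne', measure_preimage_add, inv_inv,
      abs_of_pos hN] at h1
    have h2 := ENNReal.toReal_mono (ENNReal.mul_ne_top ENNReal.ofReal_ne_top hBfin) h1
    rwa [ENNReal.toReal_mul, ENNReal.toReal_ofReal hN.le] at h2
  have hpt : ∀ w, |g (a + T w / N) - g y| ≤ ε + 2 * M * S.indicator 1 w := fun w => by
    by_cases hw : w ∈ S
    · rw [Set.indicator_of_mem hw, Pi.one_apply, mul_one]
      have := abs_sub (g (a + T w / N)) (g y)
      linarith [hM (a + T w / N), hM y]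
    · rw [Set.indicator_of_notMem hw, mul_zero, add_zero]
      have hmem : a + T w / N ∈ Set.Icc (y - 2 / N) (y + 2 / N) := by
        have h1 := abs_le.1 ha
        have h2 : 0 ≤ T w / N := div_nonneg (hT w).1 hN.le
        have h3 : T w / N ≤ 2 / N := by gcongr; linarith [(hT w).2]
        constructor <;> linarith
      by_contra h
      refine hw ⟨hmem, fun hb => h ?_⟩
      rw [Set.mem_preimage, Metric.mem_ball, Real.dist_eq] at hb
      exact hb.le
  have hind : Integrable (S.indicator (1 : Ω → ℝ)) μ := hint _ 1 fun w => by
    by_cases hw : w ∈ S <;> simp [hw]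
  have hg : Integrable (fun w => g (a + T w / N)) μ := hint _ M fun w => hM _
  calc |∫ w, g (a + T w / N) ∂μ - g y|
      = |∫ w, (g (a + T w / N) - g y) ∂μ| := by
        rw [integral_sub hg (integrable_const _)]; simp
    _ ≤ ∫ w, |g (a + T w / N) - g y| ∂μ := abs_integral_le_integral_abs
    _ ≤ ∫ w, (ε + 2 * M * S.indicator 1 w) ∂μ :=
        integral_mono (hg.sub (integrable_const _)).abs
          ((integrable_const _).add (hind.const_mul _)) hpt
    _ = ε + 2 * M * μ.real S := by
        rw [integral_add (integrable_const _) (hind.const_mul _), integral_const_mul,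
          integral_indicator_one MeasurableSet.of_discrete]
        simp
    _ ≤ ε + 2 * M * (N * volume.real B) := by gcongr
    _ = ε + 4 * M * (volume.real B / (2 / N)) := by field_simp; ring

/-! ### A partition of unity by hat functions -/

/-- The hat function supported on `[k, k + 2]`, as a difference of two ramps; this form makes the
sum over `k` telescope. -/
noncomputable def hat (k : ℕ) (z : ℝ) : ℝ :=
  max 0 (min 1 (z - k)) - max 0 (min 1 (z - (k + 1 : ℕ)))

theorem continuous_hat (k : ℕ) : Continuous (hat k) := by unfold hat; fun_prop

theorem hat_nonneg (k : ℕ) (z : ℝ) : 0 ≤ hat k z := by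
  unfold hat
  rw [sub_nonneg]
  gcongr
  exact_mod_cast k.le_succ

theorem mem_Icc_of_hat_ne_zero {k : ℕ} {z : ℝ} (h : hat k z ≠ 0) : z - k ∈ Set.Icc (0 : ℝ) 2 := by
  contrapose! h
  unfold hat
  push_cast
  rw [Set.mem_Icc, not_and_or, not_le, not_le] at h
  rcases h with h | h
  · rw [max_eq_left (min_le_of_right_le h.le), max_eq_left (min_le_of_right_le (by linarith)),
      sub_self]
  · rw [min_eq_left (by linarith), min_eq_left (by linarith), sub_self]

theorem sum_hat {K : ℕ} {z : ℝ} (h1 : 1 ≤ z) (h2 : z ≤ K) : ∑ k ∈ Finset.range K, hat k z = 1 := by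
  unfold hat
  rw [Finset.sum_range_sub' (fun k : ℕ => max 0 (min 1 (z - k))) K, Nat.cast_zero, sub_zero,
    min_eq_left h1, max_eq_right zero_le_one, max_eq_left (min_le_of_right_le (by linarith)),
    sub_zero]

/-! ### The theorem for bounded functions, and its extension to all functions -/

/-- The approximants interpolate, with hat functions of width of order `1 / N` in the variable `y`,
averages of `f (x, ·)` over intervals of length `1 / N`. Their limit is `f` because `f (x, ·)` is
approximately continuous; their class is `α` because averaging preserves the class. -/
theorem exists_seq_of_bounded {Ω : Type} [MeasurableSpace Ω] [DiscreteMeasurableSpace Ω]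
    {μ : Measure Ω} [IsProbabilityMeasure μ] {T : Ω → ℝ} (hT : ∀ w, T w ∈ Set.Icc (0 : ℝ) 1)
    (hTμ : ∀ D : Set ℝ, μ (T ⁻¹' D) ≤ volume D) {f : ℝ × ℝ → ℝ} {M : ℝ} (hM : ∀ p, |f p| ≤ M)
    {α : Ordinal.{0}} (hα : α < ω_ 1) (hx : ∀ x : ℝ, IsApproxContinuous (fun y : ℝ => f (x, y)))
    (hy : ∀ y : ℝ, IsBaire α (fun x : ℝ => f (x, y))) :
    ∃ u : ℕ → ℝ × ℝ → ℝ, (∀ n, IsBaire α (u n)) ∧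
      ∀ p, Tendsto (fun n => u n p) atTop (𝓝 (f p)) := by
  let N : ℕ → ℝ := fun n => n + 1
  have hN : ∀ n, 0 < N n := fun n => by positivity
  let a : ℕ → ℕ → ℝ := fun n k => k / N n - N n
  let A : ℕ → ℕ → ℝ → ℝ := fun n k x => ∫ w, f (x, a n k + T w / N n) ∂μ
  -- on `[-n, n]` the points `N * (y + N)` lie in `[1, 2 * N ^ 2]`, where the hats sum to `1`
  refine ⟨fun n p => ∑ k ∈ Finset.range (2 * (n + 1) ^ 2), hat k (N n * (p.2 + N n)) * A n k p.1,
    fun n => IsBaire.sum _ fun k => IsBaire.mul (IsBaire.of_continuous ?_ α) ?_, ?_⟩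
  · exact (continuous_hat k).comp (by fun_prop)
  · exact (IsBaire.integral μ hα (fun x w => hM _) fun w => hy _).comp_continuous continuous_fst
  rintro ⟨x, y⟩
  have hr : Tendsto (fun n => 2 / N n) atTop (𝓝[>] 0) := by
    refine tendsto_nhdsWithin_iff.2 ⟨?_, Eventually.of_forall fun n => div_pos two_pos (hN n)⟩
    exact tendsto_const_nhds.div_atTop
      (tendsto_atTop_add_const_right _ _ tendsto_natCast_atTop_atTop)
  rw [Metric.tendsto_atTop']
  intro ε hε
  obtain ⟨hmeas, hdens⟩ := hx x (Metric.ball (f (x, y)) (ε / 2)) Metric.isOpen_ball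
  have hlim := (((hdens y (Metric.mem_ball_self (half_pos hε))).tendsto_compl hmeas).comp
    hr).const_mul (4 * M)
  rw [mul_zero] at hlim
  have hev := (hlim.eventually (gt_mem_nhds (half_pos hε))).and
    (tendsto_natCast_atTop_atTop.eventually (eventually_ge_atTop |y|))
  obtain ⟨n₀, hn₀⟩ := eventually_atTop.1 hev
  refine ⟨n₀, fun n hn => ?_⟩
  obtain ⟨hsmall, hyn⟩ := hn₀ n hn.le
  set z := N n * (y + N n) with hz
  have hyn' := abs_le.1 hyn
  have hn0 : (0 : ℝ) ≤ n := Nat.cast_nonneg n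
  have hsum : ∑ k ∈ Finset.range (2 * (n + 1) ^ 2), hat k z = 1 := by
    refine sum_hat ?_ ?_
    · simp only [hz, N]; nlinarith
    · push_cast; simp only [hz, N]; nlinarith
  have hA : ∀ k, hat k z ≠ 0 → |A n k x - f (x, y)| < ε := fun k hk => by
    have hzk := mem_Icc_of_hat_ne_zero hk
    have hya : y - a n k = (z - k) / N n := by
      have := (hN n).ne'
      simp only [a, hz]; field_simp; ring
    have h0 : 0 ≤ y - a n k := hya ▸ div_nonneg hzk.1 (hN n).le
    have h2 : |y - a n k| ≤ 2 / N n := by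
      rw [abs_of_nonneg h0, hya]
      have := (hN n).le
      gcongr
      exact hzk.2
    have := abs_integral_sub_le hT hTμ (g := fun t => f (x, t)) (fun t => hM _)
      (half_pos hε).le (hN n) h2 (by linarith)
    simp only [Function.comp_apply] at hsmall
    have h3 : |A n k x - f (x, y)| ≤ _ := this
    linarith
  rw [Real.dist_eq]
  calc |∑ k ∈ Finset.range (2 * (n + 1) ^ 2), hat k z * A n k x - f (x, y)|
      = |∑ k ∈ Finset.range (2 * (n + 1) ^ 2), hat k z * (A n k x - f (x, y))| := by
        simp only [mul_sub, Finset.sum_sub_distrib, ← Finset.sum_mul, hsum, one_mul]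
    _ ≤ ∑ k ∈ Finset.range (2 * (n + 1) ^ 2), |hat k z * (A n k x - f (x, y))| :=
        Finset.abs_sum_le_sum_abs _ _
    _ < ∑ k ∈ Finset.range (2 * (n + 1) ^ 2), hat k z * ε := by
        have hle : ∀ k, |hat k z * (A n k x - f (x, y))| ≤ hat k z * ε := fun k => by
          by_cases hk : hat k z = 0
          · simp [hk]
          · rw [abs_mul, abs_of_nonneg (hat_nonneg k z)]
            exact mul_le_mul_of_nonneg_left (hA k hk).le (hat_nonneg k z)
        obtain ⟨k, hkm, hk⟩ := Finset.exists_ne_zero_of_sum_ne_zero (hsum ▸ one_ne_zero)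
        refine Finset.sum_lt_sum (fun k _ => hle k) ⟨k, hkm, ?_⟩
        rw [abs_mul, abs_of_nonneg (hat_nonneg k z)]
        exact mul_lt_mul_of_pos_left (hA k hk) (lt_of_le_of_ne (hat_nonneg k z) hk.symm)
    _ = ε := by rw [← Finset.sum_mul, hsum, one_mul]

/-- Approximants of `arctan ∘ f` may take values outside `(-π / 2, π / 2)`; they are truncated to
slightly smaller intervals before `tan` is applied. -/
theorem IsBaire.of_arctan {X : Type*} [TopologicalSpace X] {α : Ordinal.{0}} {f : X → ℝ}
    {u : ℕ → X → ℝ} (hu : ∀ n, IsBaire α (u n))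
    (h : ∀ x, Tendsto (fun n => u n x) atTop (𝓝 (Real.arctan (f x)))) : IsBaire (α + 1) f := by
  let c : ℕ → ℝ := fun n => Real.pi / 2 - 1 / (n + 1)
  have hclt : ∀ n, c n < Real.pi / 2 := fun n => by
    have : (0 : ℝ) < 1 / (n + 1) := by positivity
    simp only [c]; linarith
  have hcpos : ∀ n, 0 < c n := fun n => by
    have : (1 : ℝ) / (n + 1) ≤ 1 := by
      rw [div_le_one (by positivity)]; linarith [Nat.cast_nonneg (α := ℝ) n]
    simp only [c]; linarith [Real.pi_gt_three]
  have hclim : Tendsto c atTop (𝓝 (Real.pi / 2)) := by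
    simpa [c] using (tendsto_one_div_add_atTop_nhds_zero_nat (𝕜 := ℝ)).const_sub (Real.pi / 2)
  let φ : ℕ → ℝ → ℝ := fun n t => Real.tan (max (-c n) (min (c n) t))
  have hφ : ∀ n, Continuous (φ n) := fun n =>
    Real.continuousOn_tan_Ioo.comp_continuous (by fun_prop) fun t =>
      ⟨(neg_lt_neg (hclt n)).trans_le (le_max_left _ _),
        max_lt (by linarith [hclt n, hcpos n]) ((min_le_left _ _).trans_lt (hclt n))⟩
  refine IsBaire.lim (fun _ => α) (fun n x => φ n (u n x)) (fun _ => lt_add_one α)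
    (fun n => (hu n).continuous_comp (hφ n)) fun x => ?_
  have h1 : Tendsto (fun n => max (-c n) (min (c n) (u n x))) atTop (𝓝 (Real.arctan (f x))) := by
    have := hclim.neg.max (hclim.min (h x))
    rwa [min_eq_right (Real.arctan_lt_pi_div_two _).le,
      max_eq_right (by linarith [Real.neg_pi_div_two_lt_arctan (f x)])] at this
  have h2 := (Real.continuousAt_tan.2 (Real.cos_arctan_pos (f x)).ne').tendsto.comp h1
  rwa [Real.tan_arctan] at h2

theorem theorem2 (hκ : ∃ κ : Cardinal.{0}, κ ≤ 𝔠 ∧ IsRealValuedMeasurable κ)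
    (f : ℝ × ℝ → ℝ) (α : Ordinal.{0}) (hα : α < ω_ 1)
    (hx : ∀ x : ℝ, IsApproxContinuous (fun y : ℝ => f (x, y)))
    (hy : ∀ y : ℝ, IsBaire α (fun x : ℝ => f (x, y))) :
    IsBaire (α + 1) f := by
  obtain ⟨κ, hκ, -, μ, hμ, h0, -⟩ := hκ
  let _ : MeasurableSpace κ.out := ⊤
  have : DiscreteMeasurableSpace κ.out := ⟨fun _ => trivial⟩
  obtain ⟨T, hT, hTμ⟩ := exists_uniform_variable μ h0 (by rwa [Cardinal.mk_out])
  obtain ⟨u, hu, hlim⟩ := exists_seq_of_bounded hT hTμ (f := fun p => Real.arctan (f p))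
    (M := Real.pi / 2)
    (fun p => abs_le.2 ⟨by linarith [Real.neg_pi_div_two_lt_arctan (f p)],
      (Real.arctan_lt_pi_div_two _).le⟩) hα
    (fun x => (hx x).continuous_comp Real.continuous_arctan)
    (fun y => (hy y).continuous_comp Real.continuous_arctan)
  exact IsBaire.of_arctan hu hlim
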